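/- Let $(X,d)$ be a metric space and $\lambda\in(0,1)$. A finite family $f_1,\dots,f_n$ of continuous maps $X\to X$ is called $\lambda$-contractive if for all $x,y\in X$ there is an $i$ (possibly depending on $x,y$) with $d(f_i(x),f_i(y))\le\lambda\, d(x,y)$, and contractive if it is $\lambda$-contractive for some $\lambda\in(0,1)$. A word in $f_1,\dots,f_n$ is a composition $f_{i_1}\circ f_{i_2}\circ\dots\circ f_{i_m}$ with $m\ge 1$. Theorem. For every $\lambda\in(0,1)$ there are a non-empty compact metric space $X$ and continuous maps $f,g:X\to X$ such that $\{f,g\}$ is $\lambda$-contractive, that is, for all $x,y\in X$ either $d(f(x),f(y))\le\lambda\, d(x,y)$ or $d(g(x),g(y))\le\lambda\, d(x,y)$, but no word in $f,g$ has a fixed point. In particular, the assertion that for every contractive family on a non-empty compact metric space some word in its members has a fixed point (Stein's conjecture restricted to compact spaces, asked by Austin) is false. -/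

import Mathlib

/-- A finite family `F 0, …, F (n - 1)` of continuous self-maps of a metric space is
`lam`-contractive, where `0 < lam < 1`, if every pair of points is contracted by the factor `lam`
by at least one of the maps (which one may depend on the pair). -/
structure IsLambdaContractiveFamily {X : Type*} [MetricSpace X] {n : ℕ}
    (lam : ℝ) (F : Fin n → X → X) : Prop where
  pos : 0 < lam
  lt_one : lam < 1
  continuous : ∀ i, Continuous (F i)
  contracts : ∀ x y : X, ∃ i, dist (F i x) (F i y) ≤ lam * dist x y

/-- A contractive family is a family that is `lam`-contractive for some `lam` in `(0, 1)`. -/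
def IsContractiveFamily {X : Type*} [MetricSpace X] {n : ℕ} (F : Fin n → X → X) : Prop :=
  ∃ lam : ℝ, IsLambdaContractiveFamily lam F

/-- The composition `F i₁ ∘ F i₂ ∘ ⋯ ∘ F iₘ` spelled by the word `[i₁, i₂, …, iₘ]`. -/
def wordMap {X : Type*} {n : ℕ} (F : Fin n → X → X) : List (Fin n) → X → X
  | [] => id
  | i :: w => F i ∘ wordMap F w

/-- Some composition of (one or more of) the maps `F i` has a fixed point. -/
def HasWordWithFixedPoint {X : Type*} {n : ℕ} (F : Fin n → X → X) : Prop :=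
  ∃ w : List (Fin n), w ≠ [] ∧ ∃ x : X, Function.IsFixedPt (wordMap F w) x

/-- Stein's conjecture restricted to compact spaces (the positive answer to Austin's question):
every contractive family on a non-empty compact metric space has a composition with a fixed
point. -/
def SteinConjectureOnCompactSpaces : Prop :=
  ∀ (X : Type) [MetricSpace X] [CompactSpace X] [Nonempty X] (n : ℕ) (F : Fin n → X → X),
    IsContractiveFamily F → HasWordWithFixedPoint F

/-! Points are sequences of letters with counters, the two maps push a letter, and agreeing on one
more cell shrinks distance by `lam`. A push preserves agreement on `n` cells; the letter differing
from the common one in cell `n - 1` also resets counter `n` on both sides, gaining a cell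
(`exists_pushLetter_mem_cylinder_succ`). If a word of length `m` fixed a point, its letters would
have period `m`, so all `m` pushes would increment counter `m`, which must return to its value
modulo `m + 1`: impossible (`counter_wordMap_of_isFixedPt`). -/

open PiNat

section PowDist

variable {E : ℕ → Type*}

open scoped Classical in
/-- The ultrametric on a product of a sequence of types in which two sequences that first differ at
index `n` have distance `lam ^ n`. -/
noncomputable def powDist (lam : ℝ) (x y : ∀ n, E n) : ℝ :=
  if x = y then 0 else lam ^ firstDiff x y

theorem powDist_self (lam : ℝ) (x : ∀ n, E n) : powDist lam x x = 0 := by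
  simp [powDist]

theorem powDist_of_ne (lam : ℝ) {x y : ∀ n, E n} (h : x ≠ y) :
    powDist lam x y = lam ^ firstDiff x y := by
  simp [powDist, h]

theorem powDist_comm (lam : ℝ) (x y : ∀ n, E n) : powDist lam x y = powDist lam y x := by
  rcases eq_or_ne x y with rfl | hne
  · rfl
  · rw [powDist_of_ne lam hne, powDist_of_ne lam hne.symm, firstDiff_comm]

theorem powDist_nonneg {lam : ℝ} (h0 : 0 < lam) (x y : ∀ n, E n) : 0 ≤ powDist lam x y := by
  unfold powDist
  split_ifs <;> positivity

theorem powDist_le_of_mem_cylinder {lam : ℝ} (h0 : 0 < lam) (h1 : lam < 1) {x y : ∀ n, E n} {n : ℕ}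
    (h : x ∈ cylinder y n) : powDist lam x y ≤ lam ^ n := by
  rcases eq_or_ne x y with rfl | hne
  · rw [powDist_self]; positivity
  · rw [powDist_of_ne lam hne]
    exact pow_le_pow_of_le_one h0.le h1.le ((mem_cylinder_iff_le_firstDiff hne n).1 h)

theorem mem_cylinder_of_powDist_lt {lam : ℝ} (h0 : 0 < lam) (h1 : lam < 1) {x y : ∀ n, E n} {n : ℕ}
    (h : powDist lam x y < lam ^ n) : x ∈ cylinder y n := by
  rcases eq_or_ne x y with rfl | hne
  · exact self_mem_cylinder _ _
  · rw [powDist_of_ne lam hne, pow_lt_pow_iff_right_of_lt_one₀ h0 h1] at h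
    exact (mem_cylinder_iff_le_firstDiff hne n).2 h.le

theorem powDist_triangle {lam : ℝ} (h0 : 0 < lam) (h1 : lam < 1) (x y z : ∀ n, E n) :
    powDist lam x z ≤ powDist lam x y + powDist lam y z := by
  have hxy := powDist_nonneg h0 x y
  have hyz := powDist_nonneg h0 y z
  rcases eq_or_ne x z with rfl | hxz
  · rw [powDist_self]; positivity
  rcases eq_or_ne x y with rfl | hxy'
  · rw [powDist_self, zero_add]
  rcases eq_or_ne y z with rfl | hyz'
  · rw [powDist_self, add_zero]
  rw [powDist_of_ne lam hxy'] at hxy ⊢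
  rw [powDist_of_ne lam hyz'] at hyz ⊢
  rw [powDist_of_ne lam hxz]
  rcases min_le_iff.1 (min_firstDiff_le x y z hxz) with h | h
  · exact (pow_le_pow_of_le_one h0.le h1.le h).trans (le_add_of_nonneg_right hyz)
  · exact (pow_le_pow_of_le_one h0.le h1.le h).trans (le_add_of_nonneg_left hxy)

theorem eq_of_powDist_eq_zero {lam : ℝ} (h0 : 0 < lam) (x y : ∀ n, E n)
    (h : powDist lam x y = 0) : x = y := by
  by_contra hne
  rw [powDist_of_ne lam hne] at h
  exact (pow_pos h0 _).ne' h

theorem isOpen_iff_powDist [∀ n, TopologicalSpace (E n)] [∀ n, DiscreteTopology (E n)] {lam : ℝ}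
    (h0 : 0 < lam) (h1 : lam < 1) (s : Set (∀ n, E n)) :
    IsOpen s ↔ ∀ x ∈ s, ∃ ε > 0, ∀ y, powDist lam x y < ε → y ∈ s := by
  rw [(isTopologicalBasis_cylinders E).isOpen_iff]
  refine forall₂_congr fun x _ => ⟨?_, ?_⟩
  · rintro ⟨_, ⟨z, n, rfl⟩, hx, hs⟩
    refine ⟨lam ^ n, by positivity, fun y hy => hs ?_⟩
    rw [← mem_cylinder_iff_eq.1 hx, mem_cylinder_comm]
    exact mem_cylinder_of_powDist_lt h0 h1 hy
  · rintro ⟨ε, hε, hs⟩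
    obtain ⟨n, hn⟩ := exists_pow_lt_of_lt_one hε h1
    refine ⟨cylinder x n, ⟨x, n, rfl⟩, self_mem_cylinder _ _, fun y hy => hs y ?_⟩
    rw [powDist_comm]
    exact (powDist_le_of_mem_cylinder h0 h1 hy).trans_lt hn

/-- The product of a sequence of discrete spaces, metrized by `powDist`. -/
@[reducible]
noncomputable def powMetricSpace [∀ n, TopologicalSpace (E n)] [∀ n, DiscreteTopology (E n)]
    {lam : ℝ} (h0 : 0 < lam) (h1 : lam < 1) : MetricSpace (∀ n, E n) :=
  MetricSpace.ofDistTopology (powDist lam) (powDist_self lam) (powDist_comm lam)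
    (powDist_triangle h0 h1) (isOpen_iff_powDist h0 h1) (eq_of_powDist_eq_zero h0)

end PowDist

/-- A letter together with a counter modulo `q + 1`. -/
abbrev CounterCell (q : ℕ) : Type := Bool × ZMod (q + 1)

/-- A one-sided infinite sequence of letters, most recent first, in which the cell with index `q`
also counts, modulo `q + 1`, for how long each new letter has been equal to the one `q` places
before it. -/
abbrev CounterSeq : Type := ∀ q, CounterCell q

/-- Put a new letter in front of the sequence and update all the counters. -/
def pushLetter (a : Bool) (x : CounterSeq) : CounterSeq
  | 0 => (a, 0)
  | q + 1 => ((x q).1, if a = (x q).1 then (x (q + 1)).2 + 1 else 0)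

theorem pushLetter_mem_cylinder (a : Bool) {x y : CounterSeq} {n : ℕ} (h : x ∈ cylinder y n) :
    pushLetter a x ∈ cylinder (pushLetter a y) n := by
  rintro (_ | q) hq
  · rfl
  · simp only [pushLetter, h q (by omega), h (q + 1) hq]

theorem exists_pushLetter_mem_cylinder_succ {x y : CounterSeq} {n : ℕ} (h : x ∈ cylinder y n) :
    ∃ a, pushLetter a x ∈ cylinder (pushLetter a y) (n + 1) := by
  -- A mismatch resets counter `n`, erasing any disagreement there. For `n = 0` any letter works,
  -- since cell `0` becomes `(a, 0)`.
  refine ⟨!(y (n - 1)).1, ?_⟩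
  rintro (_ | q) hq
  · rfl
  · have hxy := h q (by omega)
    rcases eq_or_ne q (n - 1) with rfl | hqn
    · simp [pushLetter, hxy]
    · simp only [pushLetter, hxy, h (q + 1) (by omega)]

theorem powDist_pushLetter_le {lam : ℝ} (h0 : 0 < lam) (h1 : lam < 1) (a : Bool)
    (x y : CounterSeq) : powDist lam (pushLetter a x) (pushLetter a y) ≤ powDist lam x y := by
  rcases eq_or_ne x y with rfl | hne
  · simp only [powDist_self, le_refl]
  · rw [powDist_of_ne lam hne]
    exact powDist_le_of_mem_cylinder h0 h1
      (pushLetter_mem_cylinder a (mem_cylinder_firstDiff x y))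

theorem exists_powDist_pushLetter_le {lam : ℝ} (h0 : 0 < lam) (h1 : lam < 1) (x y : CounterSeq) :
    ∃ a, powDist lam (pushLetter a x) (pushLetter a y) ≤ lam * powDist lam x y := by
  rcases eq_or_ne x y with rfl | hne
  · exact ⟨true, by simp [powDist_self]⟩
  · obtain ⟨a, ha⟩ := exists_pushLetter_mem_cylinder_succ (mem_cylinder_firstDiff x y)
    refine ⟨a, ?_⟩
    rw [powDist_of_ne lam hne, ← pow_succ']
    exact powDist_le_of_mem_cylinder h0 h1 ha

/-- The pair of maps pushing the letters `false` and `true`. -/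
def pushMaps : Fin 2 → CounterSeq → CounterSeq := ![pushLetter false, pushLetter true]

/-- The letter that `pushMaps i` pushes. -/
def pushedLetter : Fin 2 → Bool := ![false, true]

theorem pushMaps_apply (i : Fin 2) : pushMaps i = pushLetter (pushedLetter i) := by
  fin_cases i <;> rfl

theorem wordMap_pushMaps_cons (i : Fin 2) (w : List (Fin 2)) (x : CounterSeq) :
    wordMap pushMaps (i :: w) x = pushLetter (pushedLetter i) (wordMap pushMaps w x) := by
  simp [wordMap, pushMaps_apply]

theorem wordMap_pushMaps_letter_shift (w : List (Fin 2)) (x : CounterSeq) (j : ℕ) :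
    (wordMap pushMaps w x (j + w.length)).1 = (x j).1 := by
  induction w with
  | nil => rfl
  | cons i w ih =>
    rw [wordMap_pushMaps_cons, List.length_cons, ← Nat.add_assoc]
    exact ih

theorem wordMap_pushMaps_letter_append (p : List (Fin 2)) (i : Fin 2) (v : List (Fin 2))
    (x : CounterSeq) : (wordMap pushMaps (p ++ i :: v) x p.length).1 = pushedLetter i := by
  induction p with
  | nil =>
    rw [List.nil_append, wordMap_pushMaps_cons]
    rfl
  | cons k p ih =>
    rw [List.cons_append, wordMap_pushMaps_cons, List.length_cons]
    exact ih

/-- While a word is being applied to a fixed point of it, the counter belonging to its length is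
never reset. -/
theorem counter_wordMap_of_isFixedPt {w : List (Fin 2)} {x : CounterSeq}
    (hx : Function.IsFixedPt (wordMap pushMaps w) x) (v : List (Fin 2)) (hv : v <:+ w) :
    (wordMap pushMaps v x w.length).2 = (x w.length).2 + v.length := by
  induction v with
  | nil => simp [wordMap]
  | cons i v ih =>
    obtain ⟨p, rfl⟩ := hv
    have hlen : (p ++ i :: v).length = (p.length + v.length) + 1 := by
      simp [Nat.add_assoc]
    have hletter : (wordMap pushMaps v x (p.length + v.length)).1 = pushedLetter i := by
      -- The suffix `v` has already been applied. The letter compared with the new one is letter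
      -- `p.length` of `x`, which the whole word, fixing `x`, writes there as `i`.
      rw [wordMap_pushMaps_letter_shift, ← wordMap_pushMaps_letter_append p i v x, hx]
    specialize ih ⟨p ++ [i], by simp⟩
    rw [wordMap_pushMaps_cons]
    -- The type of the counter depends on the length, so the length is made a variable before it
    -- becomes a successor.
    generalize (p ++ i :: v).length = m at hlen ih ⊢
    subst hlen
    simp [pushLetter, hletter, ih, add_assoc]

theorem not_hasWordWithFixedPoint_pushMaps : ¬ HasWordWithFixedPoint pushMaps := by
  rintro ⟨w, hw, x, hx⟩
  have h := counter_wordMap_of_isFixedPt hx w List.suffix_rfl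
  -- With `v = w` the counter equals itself plus `w.length`, so `w.length + 1` divides `w.length`.
  rw [hx, left_eq_add, ZMod.natCast_eq_zero_iff] at h
  have := Nat.le_of_dvd (List.length_pos_iff.2 hw) h
  omega

theorem exists_contractive_pair_without_fixed_words (lam : ℝ) (h0 : 0 < lam) (h1 : lam < 1) :
    ∃ (X : Type) (_ : MetricSpace X) (_ : CompactSpace X) (_ : Nonempty X) (f g : X → X),
      IsLambdaContractiveFamily lam ![f, g] ∧ ¬ HasWordWithFixedPoint ![f, g] := by
  let _ : ∀ q, TopologicalSpace (CounterCell q) := fun _ => ⊥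
  have _ : ∀ q, DiscreteTopology (CounterCell q) := fun _ => ⟨rfl⟩
  -- Tychonoff for finite cells; `powMetricSpace` keeps the product topology, so this still applies
  -- to the metric space.
  have hcompact : CompactSpace CounterSeq := inferInstance
  let _ : MetricSpace CounterSeq := powMetricSpace h0 h1
  refine ⟨CounterSeq, inferInstance, hcompact, ⟨fun _ => (false, 0)⟩, pushLetter false,
    pushLetter true, ⟨h0, h1, fun i => ?_, fun x y => ?_⟩, not_hasWordWithFixedPoint_pushMaps⟩
  · change Continuous (pushMaps i)
    rw [pushMaps_apply]
    exact (LipschitzWith.mk_one fun x y => powDist_pushLetter_le h0 h1 _ x y).continuous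
  · obtain ⟨_ | _, ha⟩ := exists_powDist_pushLetter_le h0 h1 x y
    · exact ⟨0, ha⟩
    · exact ⟨1, ha⟩

theorem theorem1 :
    (∀ lam : ℝ, 0 < lam → lam < 1 →
      ∃ (X : Type) (_ : MetricSpace X) (_ : CompactSpace X) (_ : Nonempty X) (f g : X → X),
        IsLambdaContractiveFamily lam ![f, g] ∧ ¬ HasWordWithFixedPoint ![f, g]) ∧
    ¬ SteinConjectureOnCompactSpaces := by
  refine ⟨exists_contractive_pair_without_fixed_words, fun hStein => ?_⟩
  obtain ⟨X, _, _, _, f, g, hc, hn⟩ :=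
    exists_contractive_pair_without_fixed_words (1 / 2) (by norm_num) (by norm_num)
  exact hn (hStein X 2 ![f, g] ⟨_, hc⟩)
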